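/- Setting. Let $d\ge 1$, let $p_1,p_0$ be probability densities on $\mathbb R^d$ and let $q\in(0,1)$. Let $(X,Y)$ have the joint law $\pi$ under which $\mathbb P(Y=1)=q$ and $X$ has density $p_1$ given $Y=1$ and density $p_0$ given $Y=0$; let $P_X$ be the law of $X$ and $$\eta(x)=\mathbb P(Y=1\mid X=x)=\frac{q\,p_1(x)}{(1-q)\,p_0(x)+q\,p_1(x)} .$$ With $\Lambda=p_1/p_0$ (equal to $\infty$ where $p_0=0<p_1$), the risk of using $q'\in[0,1]$ in place of $q$ is the probability of error of the detector $\mathbf 1\{\Lambda(x)\ge (1-q')/q'\}$ (the threshold being $\infty$ for $q'=0$): $$R(q')=q\int \mathbf 1\{\Lambda(x)<(1-q')/q'\}\,p_1(x)\,dx+(1-q)\int \mathbf 1\{\Lambda(x)\ge(1-q')/q'\}\,p_0(x)\,dx .$$ For $\theta\in(0,1/2)$, $\alpha\in[0,\infty)$ and $C_0>0$, let $\mathcal P_{\theta,\alpha}=\mathcal P_{\theta,\alpha}(C_0)$ be the set of all triples $(p_1,p_0,q)$ with $q\in[\theta,1-\theta]$ that satisfy the margin assumption $$P_X\bigl(0<|\eta(X)-\tfrac12|\le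 t\bigr)\le C_0\,t^{\alpha}\qquad\text{for all } t>0 .$$ Theorem. Let $\theta\in(0,1/2)$ and $\alpha\in[0,\infty)$. There is a constant $c>0$, depending only on $\theta$ and $\alpha$, such that for every $C_0\ge 2^{\alpha}$, every dimension $d\ge1$ and every sample size $n\ge1$, $$\inf_{\widehat q}\ \sup_{(p_1,p_0,q)\in\mathcal P_{\theta,\alpha}(C_0)}\Bigl(\mathbb E\bigl[R(\widehat q)\bigr]-R(q)\Bigr)\ \ge\ c\,n^{-(1+\alpha)/2},$$ where the infimum is over all estimators $\widehat q$ with values in $[0,1]$ computed from $n$ i.i.d. labeled samples $(X_i,Y_i)\sim\pi$ with knowledge of the class-conditional densities, i.e. $\widehat q$ may depend arbitrarily on $(p_1,p_0)$ and is a measurable function of the data, and the expectation is over the samples. -/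

import Mathlib

open MeasureTheory
open scoped ENNReal

namespace KnownDensities

noncomputable section

/-- The signal space `ℝ^d`. -/
abbrev Signal (d : ℕ) : Type := EuclideanSpace ℝ (Fin d)

/-- A labeled observation `(X, Y)`; the label `true` stands for `Y = 1`, `false` for `Y = 0`. -/
abbrev Observation (d : ℕ) : Type := Signal d × Bool

/-- `p` is a probability density with respect to Lebesgue measure on `ℝ^d`. -/
structure IsDensity {d : ℕ} (p : Signal d → ℝ) : Prop where
  measurable : Measurable p
  nonneg : ∀ x, 0 ≤ p x
  lintegral_eq_one : ∫⁻ x, ENNReal.ofReal (p x) = 1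

/-- The probability measure on `ℝ^d` with density `p`. -/
def densityLaw {d : ℕ} (p : Signal d → ℝ) : Measure (Signal d) :=
  (volume : Measure (Signal d)).withDensity (fun x => ENNReal.ofReal (p x))

/-- The joint law `π` of `(X, Y)`: `Y = 1` with probability `q`, and `X` has density `p₁` given
`Y = 1` and density `p₀` given `Y = 0`. -/
def jointLaw {d : ℕ} (p₁ p₀ : Signal d → ℝ) (q : ℝ) : Measure (Observation d) :=
  ENNReal.ofReal q • (densityLaw p₁).map (fun x => (x, true)) +
    ENNReal.ofReal (1 - q) • (densityLaw p₀).map (fun x => (x, false))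

/-- The marginal law `P_X` of the signal. -/
def signalLaw {d : ℕ} (p₁ p₀ : Signal d → ℝ) (q : ℝ) : Measure (Signal d) :=
  (jointLaw p₁ p₀ q).map Prod.fst

/-- The law of `n` independent labeled observations with common law `π`. -/
def sampleLaw {d : ℕ} (p₁ p₀ : Signal d → ℝ) (q : ℝ) (n : ℕ) :
    Measure (Fin n → Observation d) :=
  Measure.pi (fun _ => jointLaw p₁ p₀ q)

/-- The regression function `η(x) = P(Y = 1 | X = x)`. (The denominator vanishes only on a
`P_X`-null set when `0 < q < 1`.) -/
def regression {d : ℕ} (p₁ p₀ : Signal d → ℝ) (q : ℝ) (x : Signal d) : ℝ :=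
  q * p₁ x / ((1 - q) * p₀ x + q * p₁ x)

/-- The likelihood ratio `Λ(x) = p₁(x) / p₀(x)`, equal to `∞` where `p₀(x) = 0 < p₁(x)`. -/
def likelihoodRatio {d : ℕ} (p₁ p₀ : Signal d → ℝ) (x : Signal d) : ℝ≥0∞ :=
  ENNReal.ofReal (p₁ x) / ENNReal.ofReal (p₀ x)

/-- The threshold `(1 - q') / q'` of the detector that uses the prior `q' ∈ [0, 1]`;
it is `∞` for `q' = 0`. -/
def threshold (q' : ℝ) : ℝ≥0∞ :=
  ENNReal.ofReal (1 - q') / ENNReal.ofReal q'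

/-- `P₁(q')`: the probability under `H₁` that the detector using `q'` decides `0`. -/
def missProb {d : ℕ} (p₁ p₀ : Signal d → ℝ) (q' : ℝ) : ℝ :=
  ∫ x in {x | likelihoodRatio p₁ p₀ x < threshold q'}, p₁ x

/-- `P₀(q')`: the probability under `H₀` that the detector using `q'` decides `1`. -/
def falseAlarmProb {d : ℕ} (p₁ p₀ : Signal d → ℝ) (q' : ℝ) : ℝ :=
  ∫ x in {x | threshold q' ≤ likelihoodRatio p₁ p₀ x}, p₀ x

/-- The risk `R(q') = q P₁(q') + (1 - q) P₀(q')` (probability of error) of the detector that uses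
`q'` when the true prior is `q`. -/
def risk {d : ℕ} (p₁ p₀ : Signal d → ℝ) (q q' : ℝ) : ℝ :=
  q * missProb p₁ p₀ q' + (1 - q) * falseAlarmProb p₁ p₀ q'

/-- The margin assumption with exponent `α` and constant `C₀`:
`P_X(0 < |η(X) - 1/2| ≤ t) ≤ C₀ t^α` for all `t > 0`. -/
def MarginAssumption {d : ℕ} (C₀ α : ℝ) (p₁ p₀ : Signal d → ℝ) (q : ℝ) : Prop :=
  ∀ t : ℝ, 0 < t →
    signalLaw p₁ p₀ q
        {x | 0 < |regression p₁ p₀ q x - 1 / 2| ∧ |regression p₁ p₀ q x - 1 / 2| ≤ t} ≤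
      ENNReal.ofReal (C₀ * t ^ α)

/-- A triple `(p₁, p₀, q)`. -/
structure Triple (d : ℕ) where
  p₁ : Signal d → ℝ
  p₀ : Signal d → ℝ
  q : ℝ

/-- The class of all triples `(p₁, p₀, q)` of two densities on `ℝ^d` and a prior
`q ∈ [θ, 1 - θ]` that satisfy the margin assumption with exponent `α` and constant `C₀`. -/
def marginClass (d : ℕ) (θ α C₀ : ℝ) : Set (Triple d) :=
  {T | IsDensity T.p₁ ∧ IsDensity T.p₀ ∧ T.q ∈ Set.Icc θ (1 - θ) ∧
    MarginAssumption C₀ α T.p₁ T.p₀ T.q}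

/-- An estimator of the prior probability from `n` labeled observations with known
class-conditional densities: it may depend arbitrarily on the two densities, and for given
densities it is a measurable `[0, 1]`-valued function of the data. -/
structure Estimator (d n : ℕ) where
  est : (p₁ p₀ : Signal d → ℝ) → (Fin n → Observation d) → ℝ
  measurable_est : ∀ p₁ p₀, Measurable (est p₁ p₀)
  est_mem : ∀ p₁ p₀ s, est p₁ p₀ s ∈ Set.Icc (0 : ℝ) 1

/-- The expected excess risk `E[R(q̂)] - R(q)` of the estimator `e` at the triple `T`, the data
being `n` independent observations from the joint law that `T` determines. -/
def excessRisk {d n : ℕ} (e : Estimator d n) (T : Triple d) : ℝ :=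
  (∫ s, risk T.p₁ T.p₀ T.q (e.est T.p₁ T.p₀ s) ∂(sampleLaw T.p₁ T.p₀ T.q n)) -
    risk T.p₁ T.p₀ T.q T.q

/-- The minimax excess risk `inf_{q̂} sup_{(p₁, p₀, q)} (E[R(q̂)] - R(q))`. -/
def minimaxExcessRisk (d n : ℕ) (θ α C₀ : ℝ) : EReal :=
  ⨅ e : Estimator d n, ⨆ T ∈ marginClass d θ α C₀, ((excessRisk e T : ℝ) : EReal)

end

end KnownDensities

/-! Le Cam's two-point method. Take `m = (2h)^α` and let both densities equal `m` on a common cube;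
the remaining mass `1 - m` of each sits on a cube of its own. On the common cube `Λ = 1` and `η =
q`; elsewhere on the support `η` is `0` or `1`. For `q = 1/2 ± h` the margin condition therefore
only sees mass `m` at distance `h` and the rest at distance `1/2`, which `C₀ ≥ 2^α` allows
(`marginAssumption_cubeDensity`).

The detector acts on the common cube according to whether `q' ≥ 1/2`, and the wrong side costs at
least `2hm` (`risk_cubeDensity`, `mul_measureReal_le_excessRisk`). An estimator thus tests `1/2 + h`
against `1/2 - h`. Only the labels tell the two sample laws apart, so for `16nh² ≤ 1` the error
probabilities sum to at least `1/4` (`one_div_four_le_error_sum`). One of the two excess risks is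
then at least `hm/4`, and `h` of order `n^(-1/2)` gives the rate. -/

namespace KnownDensities

open ProbabilityTheory

/-! ### Change of measure to the fair prior -/

lemma IsDensity.isProbabilityMeasure {d : ℕ} {p : Signal d → ℝ} (hp : IsDensity p) :
    IsProbabilityMeasure (densityLaw p) :=
  ⟨by simpa [densityLaw] using hp.lintegral_eq_one⟩

lemma measurable_mk_label {d : ℕ} (b : Bool) :
    Measurable (fun x : Signal d => ((x, b) : Observation d)) :=
  measurable_id.prodMk measurable_const

lemma lintegral_jointLaw {d : ℕ} (p₁ p₀ : Signal d → ℝ) (q : ℝ) {f : Observation d → ℝ≥0∞}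
    (hf : Measurable f) :
    ∫⁻ z, f z ∂(jointLaw p₁ p₀ q) =
      ENNReal.ofReal q * ∫⁻ x, f (x, true) ∂(densityLaw p₁) +
        ENNReal.ofReal (1 - q) * ∫⁻ x, f (x, false) ∂(densityLaw p₀) := by
  rw [jointLaw, lintegral_add_measure, lintegral_smul_measure, lintegral_smul_measure,
    lintegral_map hf (measurable_mk_label _), lintegral_map hf (measurable_mk_label _)]
  rfl

lemma isProbabilityMeasure_jointLaw {d : ℕ} {p₁ p₀ : Signal d → ℝ} {q : ℝ}
    (h₁ : IsDensity p₁) (h₀ : IsDensity p₀) (hq : 0 ≤ q) (hq' : q ≤ 1) :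
    IsProbabilityMeasure (jointLaw p₁ p₀ q) := by
  have := h₁.isProbabilityMeasure
  have := h₀.isProbabilityMeasure
  refine ⟨?_⟩
  have h := lintegral_jointLaw p₁ p₀ q (f := fun _ => 1) measurable_const
  simp only [lintegral_const, measure_univ, mul_one, one_mul] at h
  rw [h, ← ENNReal.ofReal_add hq (by linarith)]
  simp

/-- The density of the label law with prior `q` with respect to the fair label law. -/
def labelDensity {d : ℕ} (q : ℝ) (z : Observation d) : ℝ := if z.2 then 2 * q else 2 * (1 - q)

lemma measurable_labelDensity {d : ℕ} (q : ℝ) : Measurable (labelDensity (d := d) q) :=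
  (measurable_of_countable (fun b : Bool => if b then 2 * q else 2 * (1 - q))).comp measurable_snd

lemma labelDensity_nonneg {d : ℕ} {q : ℝ} (hq : 0 ≤ q) (hq' : q ≤ 1) (z : Observation d) :
    0 ≤ labelDensity q z := by
  unfold labelDensity
  split_ifs <;> linarith

lemma labelDensity_mul {d : ℕ} (h : ℝ) (z : Observation d) :
    labelDensity (1 / 2 + h) z * labelDensity (1 / 2 - h) z = 1 - 4 * h ^ 2 := by
  unfold labelDensity
  split_ifs <;> ring

lemma jointLaw_eq_withDensity {d : ℕ} (p₁ p₀ : Signal d → ℝ) (q : ℝ) :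
    jointLaw p₁ p₀ q =
      (jointLaw p₁ p₀ (1 / 2)).withDensity (fun z => ENNReal.ofReal (labelDensity q z)) := by
  have half : ∀ a : ℝ, ENNReal.ofReal (1 / 2) * ENNReal.ofReal (2 * a) = ENNReal.ofReal a := by
    intro a
    rw [← ENNReal.ofReal_mul (by norm_num)]
    congr 1
    ring
  ext s hs
  have hm : Measurable (fun z : Observation d => ENNReal.ofReal (labelDensity q z)) :=
    (measurable_labelDensity q).ennreal_ofReal
  rw [withDensity_apply _ hs, ← lintegral_indicator hs,
    lintegral_jointLaw _ _ _ (hm.indicator hs), ← lintegral_indicator_one hs,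
    lintegral_jointLaw _ _ _ (measurable_one.indicator hs)]
  have key : ∀ b : Bool, ∀ p : Signal d → ℝ,
      ∫⁻ x, s.indicator (fun z => ENNReal.ofReal (labelDensity q z)) (x, b) ∂(densityLaw p) =
        ENNReal.ofReal (2 * if b then q else 1 - q) *
          ∫⁻ x, s.indicator 1 (x, b) ∂(densityLaw p) := by
    intro b p
    have hm₁ : Measurable (fun x : Signal d => s.indicator (1 : Observation d → ℝ≥0∞) (x, b)) :=
      (measurable_one.indicator hs).comp (measurable_mk_label b)
    rw [← lintegral_const_mul _ hm₁]
    congr with x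
    by_cases hx : (x, b) ∈ s <;> cases b <;> simp [hx, labelDensity]
  rw [key, key]
  simp only [if_true, Bool.false_eq_true, if_false]
  rw [← mul_assoc, ← mul_assoc, half, show (1 : ℝ) - 1 / 2 = 1 / 2 by norm_num, half]

/-- Boxes determine a product measure. The indicator of a box splits over the coordinates, so
independence factors the integral. -/
lemma pi_withDensity {ι Ω : Type*} [Fintype ι] [MeasurableSpace Ω] (μ : Measure Ω)
    [IsProbabilityMeasure μ] {g : Ω → ℝ≥0∞} (hg : Measurable g)
    [SigmaFinite (μ.withDensity g)] :
    Measure.pi (fun _ : ι => μ.withDensity g) =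
      (Measure.pi (fun _ : ι => μ)).withDensity (fun s => ∏ i, g (s i)) := by
  refine (Measure.pi_eq (fun S hS => ?_))
  rw [withDensity_apply _ (MeasurableSet.univ_pi hS),
    ← lintegral_indicator (MeasurableSet.univ_pi hS)]
  have hfm : ∀ i, Measurable ((S i).indicator g) := fun i => hg.indicator (hS i)
  have h₁ : (fun s : ι → Ω => (Set.univ.pi S).indicator (fun s => ∏ i, g (s i)) s) =
      fun s => ∏ i, (S i).indicator g (s i) := by
    funext s
    by_cases hs : s ∈ Set.univ.pi S
    · rw [Set.indicator_of_mem hs]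
      exact Finset.prod_congr rfl
        (fun i _ => (Set.indicator_of_mem (hs i (Set.mem_univ i)) g).symm)
    · rw [Set.indicator_of_notMem hs]
      obtain ⟨i, hi⟩ : ∃ i, s i ∉ S i := by simpa [Set.mem_pi] using hs
      exact (Finset.prod_eq_zero (Finset.mem_univ i) (Set.indicator_of_notMem hi g)).symm
  rw [h₁, lintegral_prod_eq_prod_lintegral_of_indepFun Finset.univ
    (fun i (s : ι → Ω) => (S i).indicator g (s i))
    (iIndepFun_pi (fun i => (hfm i).aemeasurable)) (fun i => (hfm i).comp (measurable_pi_apply i))]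
  refine Finset.prod_congr rfl (fun i _ => ?_)
  rw [withDensity_apply _ (hS i), ← lintegral_indicator (hS i)]
  exact (measurePreserving_eval (fun _ : ι => μ) i).lintegral_comp (hfm i)

lemma isProbabilityMeasure_sampleLaw {d : ℕ} {p₁ p₀ : Signal d → ℝ} {q : ℝ} (n : ℕ)
    (h₁ : IsDensity p₁) (h₀ : IsDensity p₀) (hq : 0 ≤ q) (hq' : q ≤ 1) :
    IsProbabilityMeasure (sampleLaw p₁ p₀ q n) := by
  have := isProbabilityMeasure_jointLaw h₁ h₀ hq hq'
  unfold sampleLaw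
  infer_instance

lemma sampleLaw_eq_withDensity {d : ℕ} {p₁ p₀ : Signal d → ℝ} {q : ℝ} (n : ℕ)
    (h₁ : IsDensity p₁) (h₀ : IsDensity p₀) (hq : 0 ≤ q) (hq' : q ≤ 1) :
    sampleLaw p₁ p₀ q n = (sampleLaw p₁ p₀ (1 / 2) n).withDensity
      (fun s => ENNReal.ofReal (∏ i, labelDensity q (s i))) := by
  have := isProbabilityMeasure_jointLaw h₁ h₀ (q := 1 / 2) (by norm_num) (by norm_num)
  have hjoint := isProbabilityMeasure_jointLaw h₁ h₀ hq hq'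
  have hw := jointLaw_eq_withDensity p₁ p₀ q
  rw [hw] at hjoint
  unfold sampleLaw
  rw [hw, pi_withDensity _ (measurable_labelDensity q).ennreal_ofReal]
  congr with s
  rw [ENNReal.ofReal_prod_of_nonneg (fun i _ => labelDensity_nonneg hq hq' _)]

/-! ### Indistinguishability of the two priors -/

/-- No test based on `n` observations separates the priors `1/2 + h` and `1/2 - h` when
`h` is at most of order `n ^ (-1/2)`. -/
lemma one_div_four_le_error_sum {d n : ℕ} {p₁ p₀ : Signal d → ℝ} (h₁ : IsDensity p₁)
    (h₀ : IsDensity p₀) {h : ℝ} (hpos : 0 < h) (hhalf : h ≤ 1 / 2)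
    (hn : 16 * (n * h ^ 2) ≤ 1) {F : Set (Fin n → Observation d)} (hF : MeasurableSet F) :
    1 / 4 ≤ (sampleLaw p₁ p₀ (1 / 2 + h) n).real Fᶜ + (sampleLaw p₁ p₀ (1 / 2 - h) n).real F := by
  have hP := isProbabilityMeasure_sampleLaw n h₁ h₀ (q := 1 / 2 + h) (by linarith) (by linarith)
  have hM := isProbabilityMeasure_sampleLaw n h₁ h₀ (q := 1 / 2 - h) (by linarith) (by linarith)
  have hZ := isProbabilityMeasure_sampleLaw n h₁ h₀ (q := 1 / 2) (by norm_num) (by norm_num)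
  set P := sampleLaw p₁ p₀ (1 / 2 + h) n
  set M := sampleLaw p₁ p₀ (1 / 2 - h) n
  set Z := sampleLaw p₁ p₀ (1 / 2) n
  set u : (Fin n → Observation d) → ℝ := fun s => ∏ i, labelDensity (1 / 2 + h) (s i)
  set v : (Fin n → Observation d) → ℝ := fun s => ∏ i, labelDensity (1 / 2 - h) (s i)
  have hPu : P = Z.withDensity (fun s => ENNReal.ofReal (u s)) :=
    sampleLaw_eq_withDensity n h₁ h₀ (by linarith) (by linarith)
  have hMv : M = Z.withDensity (fun s => ENNReal.ofReal (v s)) :=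
    sampleLaw_eq_withDensity n h₁ h₀ (by linarith) (by linarith)
  have hu0 : ∀ s, 0 ≤ u s := fun s =>
    Finset.prod_nonneg (fun i _ => labelDensity_nonneg (by linarith) (by linarith) _)
  have hv0 : ∀ s, 0 ≤ v s := fun s =>
    Finset.prod_nonneg (fun i _ => labelDensity_nonneg (by linarith) (by linarith) _)
  have hum : Measurable u := Finset.measurable_prod _
    (fun i _ => (measurable_labelDensity _).comp (measurable_pi_apply i))
  have hvm : Measurable v := Finset.measurable_prod _
    (fun i _ => (measurable_labelDensity _).comp (measurable_pi_apply i))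
  have huv : ∀ s, 3 / 4 ≤ u s * v s := by
    intro s
    have hprod : u s * v s = (1 - 4 * h ^ 2) ^ n := by
      simp only [u, v]
      rw [← Finset.prod_mul_distrib, Finset.prod_congr rfl (fun i _ => labelDensity_mul h (s i))]
      simp
    -- Bernoulli: `(1 - 4h²)^n ≥ 1 - 4nh² ≥ 3/4`.
    have hb := one_add_mul_le_pow (a := -(4 * h ^ 2)) (by nlinarith) n
    rw [hprod, show 1 - 4 * h ^ 2 = 1 + -(4 * h ^ 2) by ring]
    linarith
  -- AM-GM: `(17a + b)² ≥ 68ab ≥ 51 > 36`.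
  have amgm : ∀ a b : ℝ, 0 ≤ a → 0 ≤ b → 3 / 4 ≤ a * b → 6 ≤ 17 * a + b := by
    intro a b ha hb hab
    nlinarith [sq_nonneg (17 * a - b)]
  -- Either indicator turns the sum into `17a + b`, with `a`, `b` the values `u s`, `v s` in some
  -- order. Since `u` and `v` integrate to `1`, integration gives `6 ≤ 16 (P Fᶜ + M F) + 2`.
  have hpt : ∀ s, (6 : ℝ≥0∞) ≤ 16 * Fᶜ.indicator (fun s => ENNReal.ofReal (u s)) s +
      16 * F.indicator (fun s => ENNReal.ofReal (v s)) s +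
      (ENNReal.ofReal (u s) + ENNReal.ofReal (v s)) := by
    intro s
    have e16 : (16 : ℝ≥0∞) = ENNReal.ofReal 16 := by simp
    have e6 : (6 : ℝ≥0∞) = ENNReal.ofReal 6 := by simp
    by_cases hs : s ∈ F
    · rw [Set.indicator_of_notMem (by simpa using hs), Set.indicator_of_mem hs, mul_zero, zero_add,
        e16, e6, ← ENNReal.ofReal_mul (by norm_num), ← ENNReal.ofReal_add (hu0 s) (hv0 s),
        ← ENNReal.ofReal_add (by have := hv0 s; positivity) (add_nonneg (hu0 s) (hv0 s))]
      refine ENNReal.ofReal_le_ofReal ?_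
      linarith [amgm (v s) (u s) (hv0 s) (hu0 s) (by linarith [huv s, mul_comm (u s) (v s)])]
    · rw [Set.indicator_of_mem (show s ∈ Fᶜ from hs), Set.indicator_of_notMem hs, mul_zero,
        add_zero,
        e16, e6, ← ENNReal.ofReal_mul (by norm_num), ← ENNReal.ofReal_add (hu0 s) (hv0 s),
        ← ENNReal.ofReal_add (by have := hu0 s; positivity) (add_nonneg (hu0 s) (hv0 s))]
      refine ENNReal.ofReal_le_ofReal ?_
      linarith [amgm (u s) (v s) (hu0 s) (hv0 s) (huv s)]
  have hint := lintegral_mono (μ := Z) hpt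
  have hPF : ∫⁻ s, Fᶜ.indicator (fun s => ENNReal.ofReal (u s)) s ∂Z = P Fᶜ := by
    rw [hPu, withDensity_apply _ hF.compl, lintegral_indicator hF.compl]
  have hMF : ∫⁻ s, F.indicator (fun s => ENNReal.ofReal (v s)) s ∂Z = M F := by
    rw [hMv, withDensity_apply _ hF, lintegral_indicator hF]
  have hP1 : ∫⁻ s, ENNReal.ofReal (u s) ∂Z = 1 := by
    rw [← measure_univ (μ := P), hPu, withDensity_apply _ MeasurableSet.univ, setLIntegral_univ]
  have hM1 : ∫⁻ s, ENNReal.ofReal (v s) ∂Z = 1 := by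
    rw [← measure_univ (μ := M), hMv, withDensity_apply _ MeasurableSet.univ, setLIntegral_univ]
  have hui := hum.ennreal_ofReal.indicator hF.compl
  have hvi := hvm.ennreal_ofReal.indicator hF
  have huvm : Measurable (fun s => ENNReal.ofReal (u s) + ENNReal.ofReal (v s)) :=
    hum.ennreal_ofReal.add hvm.ennreal_ofReal
  rw [lintegral_add_right _ huvm,
    lintegral_add_left (hui.const_mul _), lintegral_const_mul _ hui, lintegral_const_mul _ hvi,
    lintegral_add_left hum.ennreal_ofReal, hPF, hMF, hP1, hM1, lintegral_const, measure_univ,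
    mul_one] at hint
  have hreal := ENNReal.toReal_mono (by finiteness) hint
  rw [ENNReal.toReal_add (by finiteness) (by finiteness),
    ENNReal.toReal_add (by finiteness) (by finiteness),
    ENNReal.toReal_add (by finiteness) (by finiteness), ENNReal.toReal_mul,
    ENNReal.toReal_mul] at hreal
  norm_num at hreal
  simp only [Measure.real]
  linarith

/-! ### Densities on three cubes -/

/-- The half-open unit cube with lower corner `(k, …, k)`. -/
def unitCube (d k : ℕ) : Set (Signal d) := {x | ∀ i, x i ∈ Set.Ico (k : ℝ) (k + 1)}

lemma measurableSet_unitCube (d k : ℕ) : MeasurableSet (unitCube d k) := by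
  have : unitCube d k = ⋂ i, {x : Signal d | x i ∈ Set.Ico (k : ℝ) (k + 1)} := by
    ext x
    simp [unitCube]
  rw [this]
  exact MeasurableSet.iInter fun i =>
    measurableSet_Ico.preimage (by fun_prop : Measurable fun x : Signal d => x i)

lemma volume_unitCube (d k : ℕ) : volume (unitCube d k) = 1 := by
  have hpre : unitCube d k = (WithLp.ofLp : Signal d → (Fin d → ℝ)) ⁻¹'
      (Set.univ.pi fun _ => Set.Ico (k : ℝ) (k + 1)) := by
    ext x
    simp [unitCube]
  rw [hpre, (PiLp.volume_preserving_ofLp (Fin d)).measure_preimage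
    (MeasurableSet.univ_pi fun _ => measurableSet_Ico).nullMeasurableSet, volume_pi_pi]
  simp

lemma notMem_unitCube {d j k : ℕ} (hd : 1 ≤ d) (hjk : j ≠ k) {x : Signal d}
    (hx : x ∈ unitCube d j) : x ∉ unitCube d k := by
  intro hx'
  obtain ⟨a, b⟩ := hx ⟨0, hd⟩
  obtain ⟨a', b'⟩ := hx' ⟨0, hd⟩
  have h₁ : (j : ℝ) < k + 1 := lt_of_le_of_lt a b'
  have h₂ : (k : ℝ) < j + 1 := lt_of_le_of_lt a' b
  norm_cast at h₁ h₂
  omega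

/-- The density with mass `m` spread evenly over the cube at `0` and the remaining mass over the
cube at `k`. -/
noncomputable def cubeDensity (d k : ℕ) (m : ℝ) (x : Signal d) : ℝ :=
  (unitCube d 0).indicator (fun _ => m) x + (unitCube d k).indicator (fun _ => 1 - m) x

lemma measurable_cubeDensity (d k : ℕ) (m : ℝ) : Measurable (cubeDensity d k m) :=
  (measurable_const.indicator (measurableSet_unitCube d 0)).add
    (measurable_const.indicator (measurableSet_unitCube d k))

lemma isDensity_cubeDensity (d k : ℕ) {m : ℝ} (hm : 0 ≤ m) (hm' : m ≤ 1) :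
    IsDensity (cubeDensity d k m) where
  measurable := measurable_cubeDensity d k m
  nonneg x := add_nonneg (Set.indicator_nonneg (fun _ _ => hm) x)
    (Set.indicator_nonneg (fun _ _ => by linarith) x)
  lintegral_eq_one := by
    have h : ∀ x, ENNReal.ofReal (cubeDensity d k m x) =
        (unitCube d 0).indicator (fun _ => ENNReal.ofReal m) x +
          (unitCube d k).indicator (fun _ => ENNReal.ofReal (1 - m)) x := by
      intro x
      have hm'' : 0 ≤ 1 - m := by linarith
      by_cases h0 : x ∈ unitCube d 0 <;> by_cases hk : x ∈ unitCube d k <;>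
        simp [cubeDensity, h0, hk, ← ENNReal.ofReal_add hm hm'']
    simp_rw [h]
    rw [lintegral_add_left (measurable_const.indicator (measurableSet_unitCube d 0)),
      lintegral_indicator_const (measurableSet_unitCube d 0),
      lintegral_indicator_const (measurableSet_unitCube d k), volume_unitCube, volume_unitCube,
      mul_one, mul_one, ← ENNReal.ofReal_add hm (by linarith)]
    simp

lemma densityLaw_cubeDensity_unitCube_zero {d k : ℕ} (hd : 1 ≤ d) (hk : k ≠ 0) (m : ℝ) :
    densityLaw (cubeDensity d k m) (unitCube d 0) = ENNReal.ofReal m := by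
  rw [densityLaw, withDensity_apply _ (measurableSet_unitCube d 0),
    setLIntegral_congr_fun (g := fun _ => ENNReal.ofReal m) (measurableSet_unitCube d 0)
      (fun x hx => by simp [cubeDensity, hx, notMem_unitCube hd hk.symm hx])]
  simp [volume_unitCube]

lemma cubeDensity_cases {d : ℕ} (hd : 1 ≤ d) (m : ℝ) (x : Signal d) :
    (x ∈ unitCube d 0 ∧ x ∉ unitCube d 1 ∧ x ∉ unitCube d 2 ∧
      cubeDensity d 1 m x = m ∧ cubeDensity d 2 m x = m) ∨
    (x ∉ unitCube d 0 ∧ x ∈ unitCube d 1 ∧ x ∉ unitCube d 2 ∧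
      cubeDensity d 1 m x = 1 - m ∧ cubeDensity d 2 m x = 0) ∨
    (x ∉ unitCube d 0 ∧ x ∉ unitCube d 1 ∧ x ∈ unitCube d 2 ∧
      cubeDensity d 1 m x = 0 ∧ cubeDensity d 2 m x = 1 - m) ∨
    (x ∉ unitCube d 0 ∧ x ∉ unitCube d 1 ∧ x ∉ unitCube d 2 ∧
      cubeDensity d 1 m x = 0 ∧ cubeDensity d 2 m x = 0) := by
  by_cases h0 : x ∈ unitCube d 0
  · have h1 := notMem_unitCube (k := 1) hd (by norm_num) h0
    have h2 := notMem_unitCube (k := 2) hd (by norm_num) h0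
    exact Or.inl ⟨h0, h1, h2, by simp [cubeDensity, h0, h1], by simp [cubeDensity, h0, h2]⟩
  by_cases h1 : x ∈ unitCube d 1
  · have h2 := notMem_unitCube (k := 2) hd (by norm_num) h1
    simp [cubeDensity, h0, h1, h2]
  by_cases h2 : x ∈ unitCube d 2 <;> simp [cubeDensity, h0, h1, h2]

/-! ### Error probabilities and risk of the detector -/

lemma one_lt_threshold_iff {q : ℝ} (hq : q ∈ Set.Icc (0 : ℝ) 1) :
    1 < threshold q ↔ q < 1 / 2 := by
  unfold threshold
  rcases hq.1.eq_or_lt with rfl | h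
  · simp
  · rw [← ENNReal.ofReal_div_of_pos h, ENNReal.one_lt_ofReal, one_lt_div h]
    constructor <;> intro <;> linarith

/-- On the cube that carries only `p₀` the ratio `Λ` is `0`, so the detector errs there exactly when
the threshold vanishes. -/
lemma threshold_eq_zero_iff {q : ℝ} (hq : q ∈ Set.Icc (0 : ℝ) 1) : threshold q = 0 ↔ q = 1 := by
  unfold threshold
  rw [ENNReal.div_eq_zero_iff]
  simp only [ENNReal.ofReal_eq_zero, ENNReal.ofReal_ne_top, or_false]
  constructor
  · intro
    linarith [hq.2]
  · rintro rfl
    simp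

lemma measurable_likelihoodRatio {d : ℕ} {p₁ p₀ : Signal d → ℝ} (h₁ : Measurable p₁)
    (h₀ : Measurable p₀) : Measurable (likelihoodRatio p₁ p₀) :=
  h₁.ennreal_ofReal.div h₀.ennreal_ofReal

lemma missProb_cubeDensity {d : ℕ} (hd : 1 ≤ d) {m : ℝ} (hm : 0 < m) (hm' : m ≤ 1) {q : ℝ}
    (hq : q ∈ Set.Icc (0 : ℝ) 1) :
    missProb (cubeDensity d 1 m) (cubeDensity d 2 m) q = if q < 1 / 2 then m else 0 := by
  have hS := measurableSet_lt (measurable_likelihoodRatio (measurable_cubeDensity d 1 m)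
    (measurable_cubeDensity d 2 m)) (measurable_const (a := threshold q))
  rw [missProb, ← integral_indicator hS]
  have hfun : Set.indicator {x | likelihoodRatio (cubeDensity d 1 m) (cubeDensity d 2 m) x <
      threshold q} (cubeDensity d 1 m) =
      (unitCube d 0).indicator (fun _ => if q < 1 / 2 then m else 0) := by
    funext x
    rcases cubeDensity_cases hd m x with ⟨h0, -, -, e1, e2⟩ | ⟨h0, -, -, e1, e2⟩ |
      ⟨h0, -, -, e1, e2⟩ | ⟨h0, -, -, e1, e2⟩
    · have : likelihoodRatio (cubeDensity d 1 m) (cubeDensity d 2 m) x = 1 := by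
        rw [likelihoodRatio, e1, e2]
        exact ENNReal.div_self (by simpa using hm) ENNReal.ofReal_ne_top
      simp [Set.indicator_apply, h0, this, one_lt_threshold_iff hq, e1]
    -- For `m = 1` the ratio here is `0 / 0 = 0` rather than `⊤`, but `p₁` vanishes too, so the
    -- integrand is still `0`.
    · rcases hm'.eq_or_lt with rfl | hlt
      · simp [Set.indicator_apply, h0, e1]
      · have : likelihoodRatio (cubeDensity d 1 m) (cubeDensity d 2 m) x = ⊤ := by
          rw [likelihoodRatio, e1, e2, ENNReal.ofReal_zero]
          exact ENNReal.div_zero (by simpa using hlt)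
        simp [h0, this]
    · simp [Set.indicator_apply, h0, e1]
    · simp [Set.indicator_apply, h0, e1]
  rw [hfun, integral_indicator_const _ (measurableSet_unitCube d 0)]
  simp [Measure.real, volume_unitCube]

lemma falseAlarmProb_cubeDensity {d : ℕ} (hd : 1 ≤ d) {m : ℝ} (hm : 0 < m) {q : ℝ}
    (hq : q ∈ Set.Icc (0 : ℝ) 1) :
    falseAlarmProb (cubeDensity d 1 m) (cubeDensity d 2 m) q =
      (if q < 1 / 2 then 0 else m) + if q = 1 then 1 - m else 0 := by
  have hS := measurableSet_le (measurable_const (a := threshold q))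
    (measurable_likelihoodRatio (measurable_cubeDensity d 1 m) (measurable_cubeDensity d 2 m))
  rw [falseAlarmProb, ← integral_indicator hS]
  have hfun : Set.indicator {x | threshold q ≤
      likelihoodRatio (cubeDensity d 1 m) (cubeDensity d 2 m) x} (cubeDensity d 2 m) =
      fun x => (unitCube d 0).indicator (fun _ => if q < 1 / 2 then 0 else m) x +
        (unitCube d 2).indicator (fun _ => if q = 1 then 1 - m else 0) x := by
    funext x
    rcases cubeDensity_cases hd m x with ⟨h0, -, h2, e1, e2⟩ | ⟨h0, -, h2, e1, e2⟩ |
      ⟨h0, -, h2, e1, e2⟩ | ⟨h0, -, h2, e1, e2⟩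
    · have : likelihoodRatio (cubeDensity d 1 m) (cubeDensity d 2 m) x = 1 := by
        rw [likelihoodRatio, e1, e2]
        exact ENNReal.div_self (by simpa using hm) ENNReal.ofReal_ne_top
      have hle : threshold q ≤ 1 ↔ ¬ q < 1 / 2 := by
        rw [← one_lt_threshold_iff hq, not_lt]
      rw [Set.indicator_of_mem h0, Set.indicator_of_notMem h2, add_zero]
      simp only [Set.indicator_apply, Set.mem_ofPred_eq, this, hle, e2, ite_not]
    · simp [Set.indicator_apply, h0, h2, e2]
    · have : likelihoodRatio (cubeDensity d 1 m) (cubeDensity d 2 m) x = 0 := by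
        simp [likelihoodRatio, e1]
      simp [Set.indicator_apply, h0, h2, e2, this, threshold_eq_zero_iff hq]
    · simp [Set.indicator_apply, h0, h2, e2]
  have hi : ∀ (k : ℕ) (a : ℝ), Integrable ((unitCube d k).indicator fun _ => a) volume :=
    fun k a => (integrable_indicator_iff (measurableSet_unitCube d k)).2
      (integrableOn_const (by simp [volume_unitCube]))
  rw [hfun, integral_add (hi _ _) (hi _ _),
    integral_indicator_const _ (measurableSet_unitCube d 0),
    integral_indicator_const _ (measurableSet_unitCube d 2)]
  simp [Measure.real, volume_unitCube]

lemma signalLaw_apply {d : ℕ} (p₁ p₀ : Signal d → ℝ) (q : ℝ) {s : Set (Signal d)}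
    (hs : MeasurableSet s) :
    signalLaw p₁ p₀ q s =
      ENNReal.ofReal q * densityLaw p₁ s + ENNReal.ofReal (1 - q) * densityLaw p₀ s := by
  have hc : ∀ b : Bool, Measurable (fun x : Signal d => ((x, b) : Observation d)) :=
    fun b => measurable_id.prodMk measurable_const
  rw [signalLaw, Measure.map_apply measurable_fst hs, jointLaw, Measure.add_apply,
    Measure.smul_apply, Measure.smul_apply, Measure.map_apply (hc _) (measurable_fst hs),
    Measure.map_apply (hc _) (measurable_fst hs)]
  rfl

/-- Three ranges of `t`. Below `h` the event is empty; for `h ≤ t < 1/2` it lies in the common cube,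
of mass `(2h)^α ≤ (2t)^α`; for `t ≥ 1/2` the trivial bound `1 ≤ (2t)^α` suffices. -/
lemma marginAssumption_cubeDensity {d : ℕ} (hd : 1 ≤ d) {C₀ α h q : ℝ} (hα : 0 ≤ α)
    (hC : (2 : ℝ) ^ α ≤ C₀) (hh : 0 < h) (hh' : 2 * h ≤ 1) (hq : |q - 1 / 2| = h)
    (hq0 : 0 < q) (hq1 : q < 1) :
    MarginAssumption C₀ α (cubeDensity d 1 ((2 * h) ^ α)) (cubeDensity d 2 ((2 * h) ^ α)) q := by
  set m : ℝ := (2 * h) ^ α with hm_def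
  have hm : 0 < m := by positivity
  have hm' : m ≤ 1 := Real.rpow_le_one (by positivity) hh' hα
  have hsum : ENNReal.ofReal q + ENNReal.ofReal (1 - q) = 1 := by
    rw [← ENNReal.ofReal_add hq0.le (by linarith)]
    simp
  have hbound : ∀ t : ℝ, 0 < t → (2 * t) ^ α ≤ C₀ * t ^ α := by
    intro t ht
    rw [Real.mul_rpow (by norm_num) ht.le]
    gcongr
  have hη : ∀ x, (x ∈ unitCube d 0 ∧
        |regression (cubeDensity d 1 m) (cubeDensity d 2 m) q x - 1 / 2| = h) ∨
      |regression (cubeDensity d 1 m) (cubeDensity d 2 m) q x - 1 / 2| = 1 / 2 := by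
    intro x
    unfold regression
    rcases cubeDensity_cases hd m x with ⟨h0, -, -, e1, e2⟩ | ⟨-, -, -, e1, e2⟩ |
      ⟨-, -, -, e1, e2⟩ | ⟨-, -, -, e1, e2⟩
    · refine Or.inl ⟨h0, ?_⟩
      rw [e1, e2, ← hq]
      congr 2
      field_simp
      ring
    · right
      rw [e1, e2]
      -- Where both densities vanish, `η` is `0 / 0 = 0`, again at distance `1/2`.
      rcases hm'.eq_or_lt with h1 | hlt
      · rw [h1]
        norm_num
      · have : q * (1 - m) ≠ 0 := mul_ne_zero hq0.ne' (by linarith)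
        rw [mul_zero, zero_add, div_self this]
        norm_num
    · right
      rw [e1, e2]
      norm_num
    · right
      rw [e1, e2]
      norm_num
  intro t ht
  rcases le_or_gt (1 / 2) t with hlarge | hsmall
  · refine (measure_mono (Set.subset_univ _)).trans ?_
    rw [signalLaw_apply _ _ _ MeasurableSet.univ]
    simp only [densityLaw, withDensity_apply _ MeasurableSet.univ, setLIntegral_univ,
      (isDensity_cubeDensity d 1 hm.le hm').lintegral_eq_one,
      (isDensity_cubeDensity d 2 hm.le hm').lintegral_eq_one, mul_one, hsum]
    rw [ENNReal.one_le_ofReal]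
    exact (Real.one_le_rpow (by linarith) hα).trans (hbound t ht)
  · rcases le_or_gt h t with hht | hht
    · refine (measure_mono (t := unitCube d 0) ?_).trans ?_
      · rintro x ⟨-, hx⟩
        rcases hη x with ⟨h0, -⟩ | hx'
        · exact h0
        · rw [hx'] at hx
          linarith
      · rw [signalLaw_apply _ _ _ (measurableSet_unitCube d 0),
          densityLaw_cubeDensity_unitCube_zero hd (by norm_num),
          densityLaw_cubeDensity_unitCube_zero hd (by norm_num), ← add_mul, hsum, one_mul]
        refine ENNReal.ofReal_le_ofReal (le_trans ?_ (hbound t ht))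
        exact Real.rpow_le_rpow (by positivity) (by linarith) hα
    · refine (measure_mono (t := ∅) ?_).trans (by simp)
      rintro x ⟨-, hx⟩
      rcases hη x with ⟨-, hx'⟩ | hx' <;> rw [hx'] at hx <;> linarith

lemma risk_cubeDensity {d : ℕ} (hd : 1 ≤ d) {m : ℝ} (hm : 0 < m) (hm' : m ≤ 1) (q : ℝ) {q' : ℝ}
    (hq' : q' ∈ Set.Icc (0 : ℝ) 1) :
    risk (cubeDensity d 1 m) (cubeDensity d 2 m) q q' =
      q * (if q' < 1 / 2 then m else 0) +
        (1 - q) * ((if q' < 1 / 2 then 0 else m) + if q' = 1 then 1 - m else 0) := by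
  rw [risk, missProb_cubeDensity hd hm hm' hq', falseAlarmProb_cubeDensity hd hm hq']

/-! ### Reduction from estimation to testing -/

/-- When the risk exceeds the optimal one by at least `b` on the event `A`, the expected excess
risk is at least `b` times the probability of `A`. -/
lemma mul_measureReal_le_excessRisk {d n : ℕ} (hd : 1 ≤ d) {m : ℝ} (hm : 0 < m) (hm' : m ≤ 1)
    {q : ℝ} (hq : q ∈ Set.Icc (0 : ℝ) 1) (e : Estimator d n) {b : ℝ}
    {A : Set (Fin n → Observation d)} (hA : MeasurableSet A)
    (h : ∀ s, A.indicator (fun _ => b) s ≤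
      risk (cubeDensity d 1 m) (cubeDensity d 2 m) q
          (e.est (cubeDensity d 1 m) (cubeDensity d 2 m) s) -
        risk (cubeDensity d 1 m) (cubeDensity d 2 m) q q) :
    b * (sampleLaw (cubeDensity d 1 m) (cubeDensity d 2 m) q n).real A ≤
      excessRisk e ⟨cubeDensity d 1 m, cubeDensity d 2 m, q⟩ := by
  have := isProbabilityMeasure_sampleLaw n (isDensity_cubeDensity d 1 hm.le hm')
    (isDensity_cubeDensity d 2 hm.le hm') hq.1 hq.2
  set p₁ := cubeDensity d 1 m
  set p₀ := cubeDensity d 2 m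
  set μ := sampleLaw p₁ p₀ q n
  have hint : Integrable (fun s => risk p₁ p₀ q (e.est p₁ p₀ s)) μ := by
    have he := e.measurable_est p₁ p₀
    have hlt : MeasurableSet {s | e.est p₁ p₀ s < 1 / 2} := measurableSet_lt he measurable_const
    have heq : MeasurableSet {s | e.est p₁ p₀ s = 1} := he (measurableSet_singleton 1)
    have hfun : (fun s => risk p₁ p₀ q (e.est p₁ p₀ s)) = fun s =>
        q * (if e.est p₁ p₀ s < 1 / 2 then m else 0) +
          (1 - q) * ((if e.est p₁ p₀ s < 1 / 2 then 0 else m) +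
            if e.est p₁ p₀ s = 1 then 1 - m else 0) :=
      funext fun s => risk_cubeDensity hd hm hm' q (e.est_mem p₁ p₀ s)
    rw [hfun]
    have hI : ∀ {S : Set (Fin n → Observation d)} (_ : MeasurableSet S) [DecidablePred (· ∈ S)]
        (x y : ℝ), Integrable (fun s => if s ∈ S then x else y) μ := by
      intro S hS _ x y
      refine Integrable.of_bound
        ((Measurable.ite hS measurable_const measurable_const).aestronglyMeasurable)
        (max |x| |y|) (Filter.Eventually.of_forall fun s => ?_)
      split_ifs
      · exact le_max_left _ _
      · exact le_max_right _ _
    exact ((hI hlt m 0).const_mul q).add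
      (((hI hlt 0 m).add (hI heq (1 - m) 0)).const_mul (1 - q))
  have hmono := integral_mono ((integrable_const b).indicator hA)
    (hint.sub (integrable_const (risk p₁ p₀ q q))) h
  rw [integral_indicator_const _ hA] at hmono
  simp only [Pi.sub_apply] at hmono
  rw [integral_sub hint (integrable_const _)] at hmono
  simp only [integral_const, probReal_univ, smul_eq_mul] at hmono
  rw [excessRisk]
  linarith [mul_comm b (μ.real A)]

/-- Two priors at distance `h ≤ n ^ (-1/2) / 4` on either side of `1/2` give the lower bound
`h (2h) ^ α / 4` on the excess risk. -/
lemma le_minimaxExcessRisk {d n : ℕ} (hd : 1 ≤ d) {θ α C₀ h : ℝ} (hα : 0 ≤ α) (hθ : 0 < θ)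
    (hC : (2 : ℝ) ^ α ≤ C₀) (hh : 0 < h) (hh' : h ≤ 1 / 2 - θ) (hn : 16 * (n * h ^ 2) ≤ 1) :
    ((h * (2 * h) ^ α / 4 : ℝ) : EReal) ≤ minimaxExcessRisk d n θ α C₀ := by
  refine le_iInf fun e => ?_
  set m : ℝ := (2 * h) ^ α with hm_def
  have hm : 0 < m := by positivity
  have hm' : m ≤ 1 := Real.rpow_le_one (by positivity) (by linarith) hα
  have hd₁ := isDensity_cubeDensity d 1 hm.le hm'
  have hd₀ := isDensity_cubeDensity d 2 hm.le hm'
  set F : Set (Fin n → Observation d) :=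
    {s | 1 / 2 ≤ e.est (cubeDensity d 1 m) (cubeDensity d 2 m) s} with hF_def
  have hF : MeasurableSet F := measurableSet_le measurable_const (e.measurable_est _ _)
  have hplus := mul_measureReal_le_excessRisk hd hm hm' (q := 1 / 2 + h)
    ⟨by linarith, by linarith⟩ e (b := 2 * h * m) hF.compl (by
      intro s
      have hs := e.est_mem (cubeDensity d 1 m) (cubeDensity d 2 m) s
      rw [risk_cubeDensity hd hm hm' _ hs,
        risk_cubeDensity hd hm hm' (q' := 1 / 2 + h) _ ⟨by linarith, by linarith⟩,
        if_neg (show ¬ 1 / 2 + h < 1 / 2 by linarith),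
        if_neg (show ¬ 1 / 2 + h < 1 / 2 by linarith),
        if_neg (show ¬ 1 / 2 + h = 1 by intro; linarith)]
      -- The extra false alarms of an estimate equal to `1` only raise the risk, so they can be
      -- dropped.
      have hnn : 0 ≤ (1 - (1 / 2 + h)) *
          (if e.est (cubeDensity d 1 m) (cubeDensity d 2 m) s = 1 then 1 - m else 0) :=
        mul_nonneg (by linarith) (by split_ifs <;> linarith)
      rw [mul_add (1 - (1 / 2 + h))]
      by_cases hlt : e.est (cubeDensity d 1 m) (cubeDensity d 2 m) s < 1 / 2
      · rw [Set.indicator_of_mem (by simpa [hF_def] using hlt), if_pos hlt, if_pos hlt]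
        linarith
      · rw [Set.indicator_of_notMem (by simpa [hF_def] using hlt), if_neg hlt, if_neg hlt]
        linarith)
  have hminus := mul_measureReal_le_excessRisk hd hm hm' (q := 1 / 2 - h)
    ⟨by linarith, by linarith⟩ e (b := 2 * h * m) hF (by
      intro s
      have hs := e.est_mem (cubeDensity d 1 m) (cubeDensity d 2 m) s
      rw [risk_cubeDensity hd hm hm' _ hs,
        risk_cubeDensity hd hm hm' (q' := 1 / 2 - h) _ ⟨by linarith, by linarith⟩,
        if_pos (show 1 / 2 - h < 1 / 2 by linarith),
        if_pos (show 1 / 2 - h < 1 / 2 by linarith),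
        if_neg (show ¬ 1 / 2 - h = 1 by intro; linarith)]
      have hnn : 0 ≤ (1 - (1 / 2 - h)) *
          (if e.est (cubeDensity d 1 m) (cubeDensity d 2 m) s = 1 then 1 - m else 0) :=
        mul_nonneg (by linarith) (by split_ifs <;> linarith)
      rw [mul_add (1 - (1 / 2 - h))]
      by_cases hlt : e.est (cubeDensity d 1 m) (cubeDensity d 2 m) s < 1 / 2
      · rw [Set.indicator_of_notMem (by simpa [hF_def] using hlt), if_pos hlt, if_pos hlt]
        linarith
      · rw [Set.indicator_of_mem (by simpa [hF_def] using hlt), if_neg hlt, if_neg hlt]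
        linarith)
  have hsum := mul_le_mul_of_nonneg_left
    (one_div_four_le_error_sum hd₁ hd₀ hh (by linarith) hn hF) (show 0 ≤ 2 * h * m by positivity)
  have hmem : ∀ q : ℝ, |q - 1 / 2| = h →
      (⟨cubeDensity d 1 m, cubeDensity d 2 m, q⟩ : Triple d) ∈ marginClass d θ α C₀ := by
    intro q hq
    obtain ⟨hl, hr⟩ := abs_le.1 hq.le
    exact ⟨hd₁, hd₀, ⟨by linarith, by linarith⟩, marginAssumption_cubeDensity hd hα hC hh
      (by linarith) hq (by linarith) (by linarith)⟩
  -- The two excess risks sum to at least `2hm · 1/4 = hm/2`.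
  have hcase : h * m / 4 ≤ excessRisk e ⟨cubeDensity d 1 m, cubeDensity d 2 m, 1 / 2 + h⟩ ∨
      h * m / 4 ≤ excessRisk e ⟨cubeDensity d 1 m, cubeDensity d 2 m, 1 / 2 - h⟩ := by
    by_contra! hcon
    linarith [hcon.1, hcon.2]
  rcases hcase with hc | hc
  · exact (EReal.coe_le_coe_iff.2 hc).trans (le_iSup₂_of_le _
      (hmem (1 / 2 + h) (by rw [add_sub_cancel_left, abs_of_pos hh])) le_rfl)
  · exact (EReal.coe_le_coe_iff.2 hc).trans (le_iSup₂_of_le _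
      (hmem (1 / 2 - h) (by rw [sub_sub_cancel_left, abs_neg, abs_of_pos hh])) le_rfl)

end KnownDensities

theorem theorem3 (θ α : ℝ) (hθ : 0 < θ) (hθ' : θ < 1 / 2) (hα : 0 ≤ α) :
    ∃ c : ℝ, 0 < c ∧ ∀ C₀ : ℝ, (2 : ℝ) ^ α ≤ C₀ → ∀ d n : ℕ, 1 ≤ d → 1 ≤ n →
      ((c * (n : ℝ) ^ (-(1 + α) / 2) : ℝ) : EReal) ≤
        KnownDensities.minimaxExcessRisk d n θ α C₀ := by
  -- With `h = a n^(-1/2)`, the bound `a ≤ 1/4` gives `16nh² ≤ 1`, and `a ≤ 1/2 - θ` keeps both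
  -- priors in `[θ, 1 - θ]`.
  set a : ℝ := min (1 / 4) (1 / 2 - θ)
  have ha : 0 < a := lt_min (by norm_num) (by linarith)
  have ha₁ : a ≤ 1 / 4 := min_le_left _ _
  have ha₂ : a ≤ 1 / 2 - θ := min_le_right _ _
  refine ⟨a * (2 * a) ^ α / 4, by positivity, fun C₀ hC d n hd hn => ?_⟩
  have hn₁ : (1 : ℝ) ≤ n := by exact_mod_cast hn
  have hn₀ : (0 : ℝ) < n := by linarith
  set r : ℝ := (n : ℝ) ^ (-1 / 2 : ℝ)
  have hr : 0 < r := by positivity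
  have hr₁ : r ≤ 1 := Real.rpow_le_one_of_one_le_of_nonpos hn₁ (by norm_num)
  have hr₂ : n * r ^ 2 = 1 := by
    rw [← Real.rpow_natCast, ← Real.rpow_mul hn₀.le]
    norm_num
    rw [Real.rpow_neg_one, mul_inv_cancel₀ hn₀.ne']
  have hr₃ : (n : ℝ) ^ (-(1 + α) / 2) = r * r ^ α := by
    rw [← Real.rpow_mul hn₀.le, ← Real.rpow_add hn₀]
    congr 1
    ring
  have hconst : a * (2 * a) ^ α / 4 * (n : ℝ) ^ (-(1 + α) / 2) =
      a * r * (2 * (a * r)) ^ α / 4 := by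
    rw [hr₃, ← mul_assoc 2 a r, Real.mul_rpow (by positivity) hr.le]
    ring
  rw [hconst]
  refine KnownDensities.le_minimaxExcessRisk hd hα hθ hC (by positivity)
    ((mul_le_of_le_one_right ha.le hr₁).trans ha₂) ?_
  rw [mul_pow, mul_left_comm (n : ℝ), hr₂]
  nlinarith
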